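/- **Setting.** Let $\mathbb F_q$ be a finite field, let $n,\mu\ge 1$ and $f$ be integers, and let $\phi^{(1)},\dots,\phi^{(\mu)}:\mathbb F_q^{\,f}\to\mathbb F_q$ be arbitrary candidate functions. All entropies $H$ are in $q$-ary units. For independent uniform $W^{(1)},\dots,W^{(f)}\in\mathbb F_q$ put $X^{(v)}=\phi^{(v)}(W^{(1)},\dots,W^{(f)})$, $X^{[v]}=(X^{(1)},\dots,X^{(v)})$, $H(X^{[0]})=0$ and $H_{\min}=\min_{v} H(X^{(v)})$. Each of $n$ noncolluding databases stores the same $f$ messages $\mathbf W^{(1)},\dots,\mathbf W^{(f)}$, independent and uniform on $\mathbb F_q^{\,\beta L}$, where $\beta,L$ are integers and $\beta\ge1$. Let $\mathbf X^{(v)}=(X^{(v)}_1,\dots,X^{(v)}_{\beta L})$ with $X_i^{(v)}=\phi^{(v)}(W_i^{(1)},\dots,W_i^{(f)})$, and $\mathbf X^{[v]}=(\mathbf X^{(1)},\dots,\mathbf X^{(v)})$. To compute $\mathbf X^{(v)}$ a user sends random queries $Q^{(v)}_1,\dots,Q^{(v)}_n$ (discrete, jointly independent of the messages) to the databases; database $j$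 replies with a finite string $A^{(v)}_j$ over $\mathbb F_q$ that is a deterministic function of $Q^{(v)}_j$ and the messages. A *private computation (PC) protocol* consists of an integer $\beta\ge1$ and such a scheme for every $L$, with * (privacy) for every $j$ and every $L$, the joint distribution of $(Q^{(v)}_j,A^{(v)}_j,\mathbf X^{[\mu]})$ does not depend on $v$; * (recovery) for every $v$, $H(\mathbf X^{(v)}\mid A^{(v)}_1,\dots,A^{(v)}_n,Q^{(v)}_1,\dots,Q^{(v)}_n)=o(L)$ as $L\to\infty$. Its download cost $D=D_L$ is the expected total number of symbols of $\mathbb F_q$ in the $n$ answers (by privacy the same for all $v$), its rate is $\limsup_{L\to\infty}\beta L H_{\min}/D_L$, and the PC capacity $C_{\mathrm{PC}}$ is the supremum of the rates of all PC protocols. If all candidate functions are constant, $0/0$ is read as $0$. **Theorem.** The PC capacity satisfies $$C_{\mathrm{PC}}\le \frac{n^{\mu}H_{\min}}{\sum_{v=1}^{\mu} n^{\mu-v+1}\bigl[H(X^{[v]})-H(X^{[v-1]})\bigr]} .$$ Moreover, the download cost of every PC protocol satisfies $$D_L\ \ge\ \sum_{v=1}^{\mu}\frac{H(\mathbf X^{(v)}\mid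 \mathbf X^{[v-1]})}{n^{v-1}}\;-\;o(L)\qquad(L\to\infty).$$ -/

import Mathlib

open Filter Asymptotics
open scoped ENNReal Topology

namespace PrivateComputation

noncomputable section

/-! ### Entropy of discrete random variables, in `q`-ary units -/

/-- Shannon entropy, in `q`-ary units, of a distribution on a finite alphabet. -/
def entropy (q : ℕ) {α : Type*} [Fintype α] (p : PMF α) : ℝ :=
  (∑ a, Real.negMulLog (p a).toReal) / Real.log q

/-- Conditional Shannon entropy `H(X | Y) = ∑_y P(Y = y) H(X | Y = y)`, in `q`-ary units, of two
random variables on the discrete probability space `(Ω, P)`; `X` takes values in a finite alphabet,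
`Y` in an arbitrary one. -/
def condEntropy (q : ℕ) {Ω α β : Type*} [Fintype α] (P : PMF Ω) (X : Ω → α) (Y : Ω → β) : ℝ :=
  (∑' y, (P.map Y y).toReal *
    ∑ x, Real.negMulLog ((P.map (fun ω => (X ω, Y ω)) (x, y) / P.map Y y).toReal)) / Real.log q

/-! ### Messages and candidate functions -/

/-- The contents of a database: `f` messages, each a vector of `N` symbols of `F`. -/
abbrev Messages (F : Type*) (f N : ℕ) := Fin f → Fin N → F

/-- The block `𝐗^{(v)}`: the `i`-th symbol is `φ^{(v)}(W_i^{(1)}, …, W_i^{(f)})`. -/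
def image {F : Type*} {f μ N : ℕ} (φ : Fin μ → (Fin f → F) → F) (v : Fin μ)
    (w : Messages F f N) : Fin N → F :=
  fun i => φ v (fun m => w m i)

/-- The family of blocks `𝐗^{[k]} = (𝐗^{(1)}, …, 𝐗^{(k)})` of the first `k` candidate functions. -/
def firstImages {F : Type*} {f μ N : ℕ} (φ : Fin μ → (Fin f → F) → F) (k : ℕ)
    (w : Messages F f N) : {u : Fin μ // u.val < k} → Fin N → F :=
  fun u => image φ u.val w

/-- `H(X^{(v)})` for the prototype random variable `X^{(v)} = φ^{(v)}(W^{(1)}, …, W^{(f)})`, where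
`W^{(1)}, …, W^{(f)}` are independent and uniform on `F`; the unit is `|F|`-ary. -/
def symbolEntropy {F : Type*} [Fintype F] [Nonempty F] {f μ : ℕ}
    (φ : Fin μ → (Fin f → F) → F) (v : Fin μ) : ℝ :=
  entropy (Fintype.card F) ((PMF.uniformOfFintype (Fin f → F)).map (φ v))

/-- The joint entropy `H(X^{[k]}) = H(X^{(1)}, …, X^{(k)})` of the first `k` prototype random
variables. -/
def jointSymbolEntropy {F : Type*} [Fintype F] [Nonempty F] {f μ : ℕ}
    (φ : Fin μ → (Fin f → F) → F) (k : ℕ) : ℝ :=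
  entropy (Fintype.card F) ((PMF.uniformOfFintype (Fin f → F)).map
    (fun (x : Fin f → F) (u : {u : Fin μ // u.val < k}) => φ u.val x))

/-- `H_min`, the smallest entropy of a candidate function. -/
def minEntropy {F : Type*} [Fintype F] [Nonempty F] {f μ : ℕ}
    (φ : Fin μ → (Fin f → F) → F) : ℝ :=
  ⨅ v, symbolEntropy φ v

/-! ### Protocols -/

/-- A query-answer scheme for `n` databases, each of which stores the same `f` messages of length
`N`, and `μ` indices that the user may select.  Queries are random; answers are strings of symbols
of `F` (possibly empty, of a length that may vary), and the answer of database `j` is a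
deterministic function of the query to database `j` and of the stored messages.  That function may
vary with the index `v`, as long as the condition of privacy below holds; schemes whose databases
use one function for all `v` are a special case. -/
structure Scheme (F : Type*) (f n μ N : ℕ) where
  /-- the query alphabet -/
  Query : Type
  /-- the joint law of the queries `(Q_1^{(v)}, …, Q_n^{(v)})` -/
  queryLaw : Fin μ → PMF (Fin n → Query)
  /-- `A_j^{(v)} = answer v j Q_j^{(v)} W` -/
  answer : Fin μ → Fin n → Query → Messages F f N → List F

namespace Scheme

variable {F : Type*} {f n μ N : ℕ}

/-- The joint law of the queries for index `v` and the messages.  All message symbols are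
independent and uniform on `F`, and the queries are generated independently of the messages. -/
def law [Fintype F] [Nonempty F] (S : Scheme F f n μ N) (v : Fin μ) :
    PMF ((Fin n → S.Query) × Messages F f N) :=
  (S.queryLaw v).bind fun Q =>
    (PMF.uniformOfFintype (Messages F f N)).map fun w => (Q, w)

/-- All answers `(A_1^{(v)}, …, A_n^{(v)})`. -/
def answers (S : Scheme F f n μ N) (v : Fin μ) (ω : (Fin n → S.Query) × Messages F f N) :
    Fin n → List F :=
  fun j => S.answer v j (ω.1 j) ω.2

/-- Privacy: for each database `j`, the joint law of `(Q_j^{(v)}, A_j^{(v)}, 𝐗^{[μ]})` does not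
depend on the selected index `v`. -/
def IsPrivate [Fintype F] [Nonempty F] (S : Scheme F f n μ N)
    (φ : Fin μ → (Fin f → F) → F) : Prop :=
  ∀ (v v' : Fin μ) (j : Fin n),
    (S.law v).map (fun ω => (ω.1 j, S.answers v ω j, fun u => image φ u ω.2)) =
      (S.law v').map (fun ω => (ω.1 j, S.answers v' ω j, fun u => image φ u ω.2))

/-- `H(𝐗^{(v)} | A_1^{(v)}, …, A_n^{(v)}, Q_1^{(v)}, …, Q_n^{(v)})`. -/
def equivocation [Fintype F] [Nonempty F] (S : Scheme F f n μ N)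
    (φ : Fin μ → (Fin f → F) → F) (v : Fin μ) : ℝ :=
  condEntropy (Fintype.card F) (S.law v) (fun ω => image φ v ω.2) (fun ω => (S.answers v ω, ω.1))

/-- The download cost `D`: the expected total number of symbols of `F` in the answers.  It is the
same for all indices `v` when the scheme is private; in general the worst index counts. -/
def downloadCost [Fintype F] [Nonempty F] (S : Scheme F f n μ N) : ℝ≥0∞ :=
  ⨆ v, ∑' ω, S.law v ω * ∑ j, ((S.answers v ω j).length : ℝ≥0∞)

/-- The rate `N H_min / D` of a scheme for messages of length `N` (`0 / 0 = 0`, and `a / 0 = ∞` for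
`a > 0`). -/
def rate [Fintype F] [Nonempty F] (S : Scheme F f n μ N)
    (φ : Fin μ → (Fin f → F) → F) : ℝ≥0∞ :=
  ENNReal.ofReal (N * minEntropy φ) / S.downloadCost

end Scheme

/-- A private computation protocol, given by one scheme for each `L`, with messages of length
`β L`: all schemes are private, and the desired function can be recovered from answers and queries
up to an equivocation `o(L)`, whichever index is selected. -/
def IsPCProtocol {F : Type*} [Fintype F] [Nonempty F] {f n μ : ℕ}
    (φ : Fin μ → (Fin f → F) → F) (β : ℕ) (S : ∀ L : ℕ, Scheme F f n μ (β * L)) : Prop :=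
  (∀ L, (S L).IsPrivate φ) ∧
    ∀ v, (fun L : ℕ => (S L).equivocation φ v) =o[atTop] fun L : ℕ => (L : ℝ)

/-- The PC capacity: the supremum, over all `β ≥ 1` and all PC protocols, of the rate as `L` grows.
The upper limit is taken, so protocols whose rates do not converge are counted too. -/
def capacity {F : Type*} [Fintype F] [Nonempty F] {f μ : ℕ} (n : ℕ)
    (φ : Fin μ → (Fin f → F) → F) : ℝ≥0∞ :=
  ⨆ (β : ℕ) (_ : 1 ≤ β) (S : ∀ L : ℕ, Scheme F f n μ (β * L)) (_ : IsPCProtocol φ β S),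
    limsup (fun L => (S L).rate φ) atTop

end

end PrivateComputation

namespace PrivateComputation

noncomputable section

/-! The proof tracks how much uncertainty remains in the answers as more candidate blocks become
known. By recovery, the answers for index v determine 𝐗^{(v)} up to the equivocation, so passing
from 𝐗^{[v-1]} to 𝐗^{[v]} lowers their conditional entropy by at least H(𝐗^{(v)} | 𝐗^{[v-1]}) minus
the equivocation (`unifCondEntropy_exchange`). What remains is at least the average of the entropies
of the n single answers. By privacy these equal the ones for index v+1, whose sum is at least the
joint entropy of the answers for v+1 (`answerEntropy_le`). So each change of index loses a factor n,
and chaining all indices gives the weights n^{-(v-1)}.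

The chain starts at H(A^{(1)} | Q), which must be compared with the download cost. Answers have
variable length, so their entropy may exceed the expected length; Gibbs' inequality against a
geometric weight on strings costs only a factor 1 + δ / log q and a constant independent of L
(`unifEntropy_list_le`). The bound on the capacity follows since block entropies are βL times symbol
entropies.

For fixed queries everything is a function of a uniform message, so entropies reduce to counting
fibres. Queries are averaged afterwards in [0, ∞], where series need no summability. -/

open scoped Classical in
/-- The number of points at which `Z` takes the same value as at `w`. -/
def fiberCard {M α : Type*} [Fintype M] (Z : M → α) (w : M) : ℕ :=
  (Finset.univ.filter fun u => Z u = Z w).card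

/-- Shannon entropy, in nats, of the function `Z` of a uniform random point of `M`. -/
def unifEntropy {M α : Type*} [Fintype M] (Z : M → α) : ℝ :=
  (∑ w, Real.log ((Fintype.card M : ℝ) / fiberCard Z w)) / Fintype.card M

/-- Conditional entropy, in nats, of two functions of a uniform random point of `M`. -/
def unifCondEntropy {M α β : Type*} [Fintype M] (Z : M → α) (Y : M → β) : ℝ :=
  unifEntropy (fun w => (Z w, Y w)) - unifEntropy Y

/-! ### Shannon inequalities by counting fibres -/

section FiniteEntropy

variable {M α β γ : Type*} [Fintype M]

lemma fiberCard_pos (Z : M → α) (w : M) : 0 < fiberCard Z w := by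
  classical
  exact Finset.card_pos.2 ⟨w, by simp⟩

lemma fiberCard_eq_of_eq (Z : M → α) {u w : M} (h : Z u = Z w) :
    fiberCard Z u = fiberCard Z w := by
  unfold fiberCard
  rw [h]

lemma fiberCard_mono {Z : M → α} {Y : M → β} (h : ∀ u w, Z u = Z w → Y u = Y w) (w : M) :
    fiberCard Z w ≤ fiberCard Y w := by
  classical
  unfold fiberCard
  exact Finset.card_le_card fun u => by simpa using h u w

lemma fiberCard_congr {Z : M → α} {Y : M → β} (h : ∀ u w, Z u = Z w ↔ Y u = Y w) (w : M) :
    fiberCard Z w = fiberCard Y w :=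
  le_antisymm (fiberCard_mono (fun u w => (h u w).1) w) (fiberCard_mono (fun u w => (h u w).2) w)

lemma fiberCard_le_card (Z : M → α) (w : M) : fiberCard Z w ≤ Fintype.card M := by
  classical
  exact Finset.card_le_univ _

lemma unifEntropy_congr {Z : M → α} {Y : M → β} (h : ∀ u w, Z u = Z w ↔ Y u = Y w) :
    unifEntropy Z = unifEntropy Y := by
  simp only [unifEntropy, fiberCard_congr h]

lemma unifEntropy_mono {Z : M → α} {Y : M → β} (h : ∀ u w, Z u = Z w → Y u = Y w) :
    unifEntropy Y ≤ unifEntropy Z := by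
  unfold unifEntropy
  gcongr with w
  · have := fiberCard_pos Y w
    have : 0 < Fintype.card M := Fintype.card_pos_iff.2 ⟨w⟩
    positivity
  · exact_mod_cast fiberCard_pos Z w
  · exact fiberCard_mono h w

lemma unifEntropy_nonneg (Z : M → α) : 0 ≤ unifEntropy Z := by
  refine div_nonneg (Finset.sum_nonneg fun w _ => Real.log_nonneg ?_) (by positivity)
  rw [one_le_div (by exact_mod_cast fiberCard_pos Z w)]
  exact_mod_cast fiberCard_le_card Z w

lemma unifEntropy_const (a : α) : unifEntropy (fun _ : M => a) = 0 := by
  unfold unifEntropy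
  have : ∀ w : M, Real.log ((Fintype.card M : ℝ) / fiberCard (fun _ : M => a) w) = 0 := by
    intro w
    have h : (Fintype.card M : ℝ) ≠ 0 := by
      have : 0 < Fintype.card M := Fintype.card_pos_iff.2 ⟨w⟩
      positivity
    simp [fiberCard, h]
  simp [this]

lemma unifCondEntropy_nonneg (Z : M → α) (Y : M → β) : 0 ≤ unifCondEntropy Z Y :=
  sub_nonneg.2 (unifEntropy_mono fun _ _ h => (Prod.ext_iff.1 h).2)

/-- Strong subadditivity. -/
lemma unifEntropy_submodular (X : M → α) (Y : M → β) (Z : M → γ) :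
    unifEntropy (fun w => (X w, Y w, Z w)) + unifEntropy Z ≤
      unifEntropy (fun w => (X w, Z w)) + unifEntropy (fun w => (Y w, Z w)) := by
  classical
  set xyz : M → ℝ := fun w => fiberCard (fun w => (X w, Y w, Z w)) w
  set xz : M → ℝ := fun w => fiberCard (fun w => (X w, Z w)) w
  set yz : M → ℝ := fun w => fiberCard (fun w => (Y w, Z w)) w
  set z : M → ℝ := fun w => fiberCard Z w
  have pxyz : ∀ w, 0 < xyz w := fun w => Nat.cast_pos.2 (fiberCard_pos _ w)
  have pxz : ∀ w, 0 < xz w := fun w => Nat.cast_pos.2 (fiberCard_pos _ w)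
  have pyz : ∀ w, 0 < yz w := fun w => Nat.cast_pos.2 (fiberCard_pos _ w)
  have pz : ∀ w, 0 < z w := fun w => Nat.cast_pos.2 (fiberCard_pos _ w)
  -- By log t ≤ t - 1 the claim reduces to this count. Expand the numerator over pairs (u, u'). For
  -- a fixed pair the contributing w form at most one fibre of (X, Y, Z), which contributes 1 / z,
  -- and only if Z u = Z u'. Summing over u' then gives 1 for each u.
  have key : ∑ w, xz w * yz w / (xyz w * z w) ≤ Fintype.card M := by
    have e1 : ∀ w, xz w * yz w / (xyz w * z w) = ∑ u, ∑ u',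
        if (X u = X w ∧ Z u = Z w) ∧ (Y u' = Y w ∧ Z u' = Z w) then (xyz w * z w)⁻¹ else 0 := by
      intro w
      have hx : xz w = ∑ u, if (X u = X w ∧ Z u = Z w) then (1 : ℝ) else 0 := by
        simp [xz, fiberCard]
      have hy : yz w = ∑ u, if (Y u = Y w ∧ Z u = Z w) then (1 : ℝ) else 0 := by
        simp [yz, fiberCard]
      rw [hx, hy, div_eq_mul_inv, Finset.sum_mul_sum, Finset.sum_mul]
      refine Finset.sum_congr rfl fun u _ => ?_
      rw [Finset.sum_mul]
      refine Finset.sum_congr rfl fun u' _ => ?_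
      split_ifs <;> simp_all
    have e2 : ∀ u u', (∑ w, if (X u = X w ∧ Z u = Z w) ∧ (Y u' = Y w ∧ Z u' = Z w)
        then (xyz w * z w)⁻¹ else 0) ≤ if Z u' = Z u then (z u)⁻¹ else 0 := by
      intro u u'
      by_cases hne : ∃ w, (X u = X w ∧ Z u = Z w) ∧ (Y u' = Y w ∧ Z u' = Z w)
      · obtain ⟨w₀, ⟨h1, h2⟩, h3, h4⟩ := hne
        have hz : z u = z w₀ := by simp only [z]; rw [fiberCard_eq_of_eq Z h2]
        rw [if_pos (h4.trans h2.symm), hz]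
        have : ∀ w, (if (X u = X w ∧ Z u = Z w) ∧ (Y u' = Y w ∧ Z u' = Z w)
            then (xyz w * z w)⁻¹ else 0) =
            if (X w, Y w, Z w) = (X w₀, Y w₀, Z w₀) then (xyz w₀ * z w₀)⁻¹ else 0 := by
          intro w
          by_cases hw : (X w, Y w, Z w) = (X w₀, Y w₀, Z w₀)
          · have hh := hw
            simp only [Prod.mk.injEq] at hh
            have a1 : xyz w = xyz w₀ := by
              simp only [xyz]; rw [fiberCard_eq_of_eq (fun w => (X w, Y w, Z w)) hw]
            have a2 : z w = z w₀ := by simp only [z]; rw [fiberCard_eq_of_eq Z hh.2.2]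
            rw [if_pos hw, if_pos, a1, a2]
            grind
          · rw [if_neg hw, if_neg]
            simp only [Prod.mk.injEq] at hw
            grind
        rw [Finset.sum_congr rfl fun w _ => this w, ← Finset.sum_filter, Finset.sum_const,
          nsmul_eq_mul]
        have hc : (((Finset.univ.filter fun w =>
          (X w, Y w, Z w) = (X w₀, Y w₀, Z w₀)).card : ℕ) : ℝ) = xyz w₀ := by
          simp only [xyz, fiberCard]
        rw [hc, mul_inv, ← mul_assoc, mul_inv_cancel₀ (pxyz w₀).ne', one_mul]
      · push Not at hne
        rw [Finset.sum_eq_zero]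
        · split_ifs
          · exact (inv_pos.2 (pz u)).le
          · exact le_rfl
        · intro w _
          rw [if_neg]
          grind
    calc _ = ∑ u, ∑ u', ∑ w, (if (X u = X w ∧ Z u = Z w) ∧ (Y u' = Y w ∧ Z u' = Z w)
        then (xyz w * z w)⁻¹ else 0) := by
          rw [Finset.sum_congr rfl fun w _ => e1 w, Finset.sum_comm]
          exact Finset.sum_congr rfl fun u _ => Finset.sum_comm
      _ ≤ ∑ u, ∑ u', if Z u' = Z u then (z u)⁻¹ else 0 :=
          Finset.sum_le_sum fun u _ => Finset.sum_le_sum fun u' _ => e2 u u'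
      _ = ∑ u : M, (1 : ℝ) := by
          refine Finset.sum_congr rfl fun u _ => ?_
          rw [← Finset.sum_filter, Finset.sum_const, nsmul_eq_mul]
          exact mul_inv_cancel₀ (pz u).ne'
      _ = _ := by simp
  unfold unifEntropy
  rw [← add_div, ← add_div, ← Finset.sum_add_distrib, ← Finset.sum_add_distrib]
  refine div_le_div_of_nonneg_right ?_ (by positivity)
  rw [← sub_nonpos, ← Finset.sum_sub_distrib]
  calc _ ≤ ∑ w, (xz w * yz w / (xyz w * z w) - 1) := by
        refine Finset.sum_le_sum fun w _ => ?_
        have hM : (Fintype.card M : ℝ) ≠ 0 := by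
          have : 0 < Fintype.card M := Fintype.card_pos_iff.2 ⟨w⟩
          positivity
        have := pxyz w; have := pxz w; have := pyz w; have := pz w
        refine le_trans (le_of_eq ?_) (Real.log_le_sub_one_of_pos (by positivity))
        change Real.log (_ / xyz w) + Real.log (_ / z w) -
          (Real.log (_ / xz w) + Real.log (_ / yz w)) = _
        rw [Real.log_div hM (by positivity), Real.log_div hM (by positivity),
          Real.log_div hM (by positivity), Real.log_div hM (by positivity),
          Real.log_div (by positivity) (by positivity), Real.log_mul (by positivity) (by positivity),
          Real.log_mul (by positivity) (by positivity)]
        ring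
    _ ≤ 0 := by
        rw [Finset.sum_sub_distrib]
        simpa using key

/-- Conditional entropy of a family is at most the sum of the conditional entropies. -/
lemma unifCondEntropy_pi_le {n : ℕ} {A : Fin n → M → α} (X : M → β) :
    unifCondEntropy (fun w j => A j w) X ≤ ∑ j, unifCondEntropy (A j) X := by
  classical
  -- Masking the entries outside s by `none` keeps the type of the family fixed during the induction
  -- on s.
  have key : ∀ s : Finset (Fin n),
      unifCondEntropy (fun w j => if j ∈ s then some (A j w) else none) X ≤
        ∑ j ∈ s, unifCondEntropy (A j) X := by
    intro s
    induction s using Finset.induction_on with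
    | empty =>
      simp only [Finset.sum_empty, unifCondEntropy, sub_nonpos]
      exact unifEntropy_mono fun u w h => by simpa using h
    | insert a s ha ih =>
      rw [Finset.sum_insert ha]
      have h := unifEntropy_submodular (A a)
        (fun w j => if j ∈ s then some (A j w) else none) X
      have h' : unifEntropy (fun w =>
          ((fun j => if j ∈ insert a s then some (A j w) else none), X w)) =
          unifEntropy (fun w => (A a w, (fun j => if j ∈ s then some (A j w) else none), X w)) := by
        refine unifEntropy_congr fun u w => ?_
        simp only [Prod.mk.injEq, funext_iff, Finset.mem_insert]
        constructor
        · rintro ⟨h1, h2⟩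
          refine ⟨by simpa using h1 a, fun j => ?_, h2⟩
          have := h1 j
          by_cases hj : j ∈ s <;> simp_all
        · rintro ⟨h1, h2, h3⟩
          refine ⟨fun j => ?_, h3⟩
          have := h2 j
          by_cases hja : j = a
          · subst hja; simp [h1]
          · simpa [hja] using this
      unfold unifCondEntropy at *
      rw [h']
      linarith
  have := key Finset.univ
  refine le_trans (le_of_eq ?_) this
  unfold unifCondEntropy
  congr 1
  exact unifEntropy_congr fun u w => by simp [funext_iff]

/-- Each member is a function of the whole family. -/
lemma sum_unifCondEntropy_le {n : ℕ} {A : Fin n → M → α} (X : M → β) :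
    ∑ j, unifCondEntropy (A j) X ≤ n * unifCondEntropy (fun w j => A j w) X := by
  have : ∀ j ∈ Finset.univ, unifCondEntropy (A j) X ≤ unifCondEntropy (fun w j => A j w) X := by
    intro j _
    refine sub_le_sub_right (unifEntropy_mono fun u w h => ?_) _
    simp only [Prod.mk.injEq, funext_iff] at h ⊢
    exact ⟨h.1 j, h.2⟩
  simpa using Finset.sum_le_card_nsmul _ _ _ this

/-- Recovering `X` from `A`, in entropies. -/
lemma unifCondEntropy_exchange {δ : Type*} (A : M → α) (X : M → β) (Y : M → γ) (Y' : M → δ)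
    (h : ∀ u w, Y' u = Y' w ↔ X u = X w ∧ Y u = Y w) :
    unifCondEntropy X Y + unifCondEntropy A Y' ≤ unifCondEntropy A Y + unifCondEntropy X A := by
  -- This is H(X | Y, A) ≤ H(X | A); the rest is the chain rule.
  have h1 := unifEntropy_submodular X Y A
  have e1 : unifEntropy (fun w => (X w, Y w, A w)) = unifEntropy (fun w => (A w, Y' w)) :=
    unifEntropy_congr fun u w => by simp only [Prod.mk.injEq, h]; tauto
  have e2 : unifEntropy (fun w => (Y w, A w)) = unifEntropy (fun w => (A w, Y w)) :=
    unifEntropy_congr fun u w => by simp only [Prod.mk.injEq]; tauto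
  have e3 : unifEntropy (fun w => (X w, Y w)) = unifEntropy Y' :=
    unifEntropy_congr fun u w => by simp only [Prod.mk.injEq, h]
  unfold unifCondEntropy
  linarith

lemma unifCondEntropy_of_forall_eq (Z : M → α) {Y : M → β} (h : ∀ u w, Y u = Y w) :
    unifCondEntropy Z Y = unifEntropy Z := by
  rw [unifCondEntropy, unifEntropy_congr (Y := fun _ => ()) (Z := Y) (by simpa using h),
    unifEntropy_const, sub_zero]
  exact unifEntropy_congr fun u w => by simp [h u w]

/-- A sum over fibres. -/
lemma sum_div_fiberCard [DecidableEq α] (Z : M → α) (r : α → ℝ) :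
    ∑ w, r (Z w) / fiberCard Z w = ∑ a ∈ Finset.univ.image Z, r a := by
  classical
  rw [← Finset.sum_fiberwise_of_maps_to (t := Finset.univ.image Z) (g := Z) (by simp)]
  refine Finset.sum_congr rfl fun a ha => ?_
  obtain ⟨w₀, -, rfl⟩ := Finset.mem_image.1 ha
  have : ∀ w ∈ Finset.univ.filter (fun w => Z w = Z w₀),
      r (Z w) / fiberCard Z w = r (Z w₀) / fiberCard Z w₀ := by
    intro w hw
    have hw : Z w = Z w₀ := by simpa using hw
    rw [fiberCard_eq_of_eq Z hw, hw]
  rw [Finset.sum_congr rfl this, Finset.sum_const, nsmul_eq_mul]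
  have h0 : (fiberCard Z w₀ : ℝ) ≠ 0 := by exact_mod_cast (fiberCard_pos Z w₀).ne'
  have : (((Finset.univ.filter (fun w => Z w = Z w₀)).card : ℕ) : ℝ) = fiberCard Z w₀ := by
    simp only [fiberCard]; congr!
  rw [this]
  field_simp

/-- Gibbs' inequality, for a subprobability weight `r`. -/
lemma unifEntropy_le_of_sum_le_one [Nonempty M] (Z : M → α) (r : α → ℝ) (hr : ∀ a, 0 < r a)
    (hs : ∀ s : Finset α, ∑ a ∈ s, r a ≤ 1) :
    unifEntropy Z ≤ (∑ w, -Real.log (r (Z w))) / Fintype.card M := by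
  classical
  have hM : (0 : ℝ) < Fintype.card M := by exact_mod_cast Fintype.card_pos
  refine div_le_div_of_nonneg_right ?_ hM.le
  rw [← sub_nonpos, ← Finset.sum_sub_distrib]
  calc _ ≤ ∑ w, (Fintype.card M * (r (Z w) / fiberCard Z w) - 1) := by
        refine Finset.sum_le_sum fun w _ => ?_
        have h1 : (0 : ℝ) < fiberCard Z w := by exact_mod_cast fiberCard_pos Z w
        have h2 := hr (Z w)
        refine le_trans (le_of_eq ?_) (Real.log_le_sub_one_of_pos (by positivity))
        rw [Real.log_mul hM.ne' (by positivity), Real.log_div hM.ne' h1.ne',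
          Real.log_div h2.ne' h1.ne']
        ring
    _ ≤ 0 := by
        rw [Finset.sum_sub_distrib, ← Finset.mul_sum, sum_div_fiberCard]
        have := hs (Finset.univ.image Z)
        simp only [Finset.sum_const, Finset.card_univ, nsmul_eq_mul, mul_one]
        nlinarith

/-- There are at most |F|^m strings of length m, so length m has total weight at most (1 - t) t^m,
and the geometric series sums to at most 1. -/
lemma sum_list_weight_le_one {F : Type*} [Fintype F] [Nonempty F] {t : ℝ} (h0 : 0 < t) (h1 : t < 1)
    (s : Finset (List F)) :
    ∑ a ∈ s, (1 - t) * (t / Fintype.card F) ^ a.length ≤ 1 := by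
  classical
  have hk : (0 : ℝ) < Fintype.card F := by exact_mod_cast Fintype.card_pos
  obtain ⟨K, hK⟩ : ∃ K, ∀ a ∈ s, a.length < K :=
    ⟨s.sup List.length + 1, fun a ha => Nat.lt_succ_of_le (Finset.le_sup (f := List.length) ha)⟩
  rw [← Finset.sum_fiberwise_of_maps_to (t := Finset.range K) (g := List.length)
    (by simpa using hK)]
  calc _ ≤ ∑ m ∈ Finset.range K, (1 - t) * t ^ m := by
        refine Finset.sum_le_sum fun m _ => ?_
        have : ∀ a ∈ s.filter (fun a => a.length = m),
            (1 - t) * (t / Fintype.card F) ^ a.length =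
              (1 - t) * (t / Fintype.card F : ℝ) ^ m := by
          intro a ha
          rw [(Finset.mem_filter.1 ha).2]
        rw [Finset.sum_congr rfl this, Finset.sum_const, nsmul_eq_mul]
        have hc : (s.filter (fun a => a.length = m)).card ≤ Fintype.card F ^ m := by
          rw [← card_vector (α := F) m, ← Finset.card_univ]
          refine le_trans (Finset.card_le_card fun a ha => ?_) (Finset.card_map
            (s := (Finset.univ : Finset (List.Vector F m)))
            ⟨(Subtype.val : List.Vector F m → List F), Subtype.val_injective⟩).le
          exact Finset.mem_map.2 ⟨⟨a, (Finset.mem_filter.1 ha).2⟩, Finset.mem_univ _, rfl⟩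
        have hc' : ((s.filter (fun a => a.length = m)).card : ℝ) ≤ (Fintype.card F : ℝ) ^ m := by
          exact_mod_cast hc
        have h1t : 0 < 1 - t := by linarith
        calc _ ≤ (Fintype.card F : ℝ) ^ m * ((1 - t) * (t / Fintype.card F : ℝ) ^ m) := by
              gcongr
          _ = _ := by rw [div_pow]; field_simp
    _ = 1 - t ^ K := by
        rw [← Finset.mul_sum]
        have := geom_sum_mul t K
        linarith
    _ ≤ 1 := by have := pow_pos h0 K; linarith

/-- The entropy of a random string is at most its expected length, up to a factor close to `1` and
an additive constant. -/
lemma unifEntropy_list_le [Nonempty M] {F : Type*} [Fintype F] [Nonempty F] (A : M → List F)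
    {δ : ℝ} (hδ : 0 < δ) :
    unifEntropy A ≤ (Real.log (Fintype.card F) + δ) *
      ((∑ w, ((A w).length : ℝ)) / Fintype.card M) - Real.log (1 - Real.exp (-δ)) := by
  have hk : (0 : ℝ) < Fintype.card F := by exact_mod_cast Fintype.card_pos
  have hM : (0 : ℝ) < Fintype.card M := by exact_mod_cast Fintype.card_pos
  have h0 := Real.exp_pos (-δ)
  have h1 : Real.exp (-δ) < 1 := by simpa using hδ
  have h1t : 0 < 1 - Real.exp (-δ) := by linarith
  refine (unifEntropy_le_of_sum_le_one A
    (fun a => (1 - Real.exp (-δ)) * (Real.exp (-δ) / Fintype.card F) ^ a.length)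
    (fun a => by positivity) (sum_list_weight_le_one h0 h1)).trans (le_of_eq ?_)
  have : ∀ w, -Real.log ((1 - Real.exp (-δ)) * (Real.exp (-δ) / Fintype.card F) ^ (A w).length) =
      (Real.log (Fintype.card F) + δ) * (A w).length - Real.log (1 - Real.exp (-δ)) := by
    intro w
    rw [Real.log_mul h1t.ne' (by positivity), Real.log_pow, Real.log_div h0.ne' hk.ne',
      Real.log_exp]
    ring
  simp only [this]
  rw [Finset.sum_sub_distrib, ← Finset.mul_sum]
  simp only [Finset.sum_const, Finset.card_univ, nsmul_eq_mul]
  field_simp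

end FiniteEntropy

/-! ### Entropy as a function of the law -/

section Laws

variable {M α β : Type*} [Fintype M] [Nonempty M]

lemma toReal_map_uniformOfFintype_apply (Z : M → α) (w : M) :
    ((PMF.uniformOfFintype M).map Z (Z w)).toReal = fiberCard Z w / Fintype.card M := by
  classical
  rw [PMF.map_apply, tsum_fintype, ← Finset.sum_filter,
    Finset.filter_congr (q := fun u => Z u = Z w) fun u _ => eq_comm]
  simp only [PMF.uniformOfFintype_apply, Finset.sum_const, nsmul_eq_mul, ENNReal.toReal_mul,
    ENNReal.toReal_natCast, ENNReal.toReal_inv, fiberCard, div_eq_mul_inv]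

lemma map_uniformOfFintype_apply_eq_zero (Z : M → α) {a : α} (h : ∀ w, Z w ≠ a) :
    (PMF.uniformOfFintype M).map Z a = 0 := by
  rw [PMF.map_apply, ENNReal.tsum_eq_zero]
  exact fun w => if_neg fun e => h w e.symm

/-- The entropy as a function of the law, summed over any finite set that supports it. -/
lemma unifEntropy_eq_sum (Z : M → α) (s : Finset α) (hs : ∀ w, Z w ∈ s) :
    unifEntropy Z = ∑ a ∈ s, Real.negMulLog ((PMF.uniformOfFintype M).map Z a).toReal := by
  classical
  rw [← Finset.sum_subset (s₁ := Finset.univ.image Z) (by simpa [Finset.subset_iff] using hs),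
    ← sum_div_fiberCard, unifEntropy, Finset.sum_div]
  · refine Finset.sum_congr rfl fun w _ => ?_
    have h1 : (0 : ℝ) < fiberCard Z w := Nat.cast_pos.2 (fiberCard_pos _ w)
    have hM : (0 : ℝ) < Fintype.card M := Nat.cast_pos.2 Fintype.card_pos
    rw [toReal_map_uniformOfFintype_apply, Real.negMulLog, Real.log_div hM.ne' h1.ne',
      Real.log_div h1.ne' hM.ne']
    field_simp
    ring
  · intro a _ ha
    rw [map_uniformOfFintype_apply_eq_zero]
    · simp
    · simpa using ha

/-- Privacy is an equality of laws; this carries it over to entropies defined by fibres. -/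
lemma unifEntropy_eq_of_map_eq {Z Z' : M → α}
    (h : (PMF.uniformOfFintype M).map Z = (PMF.uniformOfFintype M).map Z') :
    unifEntropy Z = unifEntropy Z' := by
  classical
  rw [unifEntropy_eq_sum Z (Finset.univ.image Z ∪ Finset.univ.image Z') (by simp),
    unifEntropy_eq_sum Z' (Finset.univ.image Z ∪ Finset.univ.image Z') (by simp), h]

lemma entropy_map_uniformOfFintype [Fintype α] (q : ℕ) (Z : M → α) :
    entropy q ((PMF.uniformOfFintype M).map Z) = unifEntropy Z / Real.log q := by
  rw [entropy, unifEntropy_eq_sum Z Finset.univ (by simp)]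

end Laws

/-! ### Conditional entropy of discrete random variables -/

section CondEntropy

variable {Ω α β : Type*}

lemma map_prodMk_apply_le (P : PMF Ω) (X : Ω → α) (Y : Ω → β) (x : α) (y : β) :
    P.map (fun ω => (X ω, Y ω)) (x, y) ≤ P.map Y y := by
  classical
  rw [PMF.map_apply, PMF.map_apply]
  refine ENNReal.tsum_le_tsum fun ω => ?_
  split_ifs <;> simp_all

lemma toReal_div_mem_Icc (P : PMF Ω) (X : Ω → α) (Y : Ω → β) (x : α) (y : β) :
    (P.map (fun ω => (X ω, Y ω)) (x, y) / P.map Y y).toReal ∈ Set.Icc (0 : ℝ) 1 := by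
  refine ⟨ENNReal.toReal_nonneg, ENNReal.toReal_le_of_le_ofReal zero_le_one ?_⟩
  rw [ENNReal.ofReal_one]
  exact ENNReal.div_le_of_le_mul (by simpa using map_prodMk_apply_le P X Y x y)

/-- Boundedness of g makes the real series summable, so its `tsum` is not the default value 0. -/
lemma ofReal_tsum_toReal_mul (P : PMF β) (g : β → ℝ) (C : ℝ) (h0 : ∀ y, 0 ≤ g y)
    (hC : ∀ y, g y ≤ C) :
    ENNReal.ofReal (∑' y, (P y).toReal * g y) = ∑' y, P y * ENNReal.ofReal (g y) := by
  have hs : Summable fun y => (P y).toReal := ENNReal.summable_toReal P.tsum_coe_ne_top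
  rw [ENNReal.ofReal_tsum_of_nonneg (fun y => mul_nonneg ENNReal.toReal_nonneg (h0 y))]
  · refine tsum_congr fun y => ?_
    rw [ENNReal.ofReal_mul ENNReal.toReal_nonneg, ENNReal.ofReal_toReal (P.apply_ne_top y)]
  · exact Summable.of_nonneg_of_le (fun y => mul_nonneg ENNReal.toReal_nonneg (h0 y))
      (fun y => mul_le_mul_of_nonneg_left (hC y) ENNReal.toReal_nonneg) (hs.mul_right C)

variable [Fintype α]

lemma sum_map_prodMk_apply (P : PMF Ω) (X : Ω → α) (Y : Ω → β) (y : β) :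
    ∑ x, P.map (fun ω => (X ω, Y ω)) (x, y) = P.map Y y := by
  classical
  simp only [PMF.map_apply]
  rw [← tsum_fintype (L := .unconditional _), ENNReal.tsum_comm]
  refine tsum_congr fun ω => ?_
  rw [tsum_fintype]
  simp [ite_and]

lemma condEntropy_mul_log {q : ℕ} (hq : 1 < q) (P : PMF Ω) (X : Ω → α) (Y : Ω → β) :
    ENNReal.ofReal (condEntropy q P X Y * Real.log q) = ∑' y, P.map Y y * ENNReal.ofReal
      (∑ x, Real.negMulLog ((P.map (fun ω => (X ω, Y ω)) (x, y) / P.map Y y).toReal)) := by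
  have hl : Real.log q ≠ 0 := (Real.log_pos (by exact_mod_cast hq)).ne'
  rw [condEntropy, div_mul_cancel₀ _ hl]
  refine ofReal_tsum_toReal_mul _ _ (∑ _x : α, 1) (fun y => ?_) (fun y => ?_)
  · exact Finset.sum_nonneg fun x _ => Real.negMulLog_nonneg (toReal_div_mem_Icc P X Y x y).1
      (toReal_div_mem_Icc P X Y x y).2
  · refine Finset.sum_le_sum fun x _ => ?_
    have h := toReal_div_mem_Icc P X Y x y
    refine (Real.negMulLog_le_one_sub_self h.1).trans ?_
    linarith [h.1]

lemma condEntropy_nonneg (q : ℕ) (P : PMF Ω) (X : Ω → α) (Y : Ω → β) :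
    0 ≤ condEntropy q P X Y := by
  refine div_nonneg (tsum_nonneg fun y => mul_nonneg ENNReal.toReal_nonneg
    (Finset.sum_nonneg fun x _ => Real.negMulLog_nonneg (toReal_div_mem_Icc P X Y x y).1
      (toReal_div_mem_Icc P X Y x y).2)) (Real.log_natCast_nonneg q)

lemma condEntropy_uniformOfFintype {M : Type*} [Fintype M] [Nonempty M] (q : ℕ) (X : M → α)
    (Y : M → β) :
    condEntropy q (PMF.uniformOfFintype M) X Y = unifCondEntropy X Y / Real.log q := by
  classical
  rw [condEntropy]
  congr 1
  rw [tsum_eq_sum (s := Finset.univ.image Y)]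
  · rw [unifCondEntropy, unifEntropy_eq_sum Y (Finset.univ.image Y) (by simp),
      unifEntropy_eq_sum (fun w => (X w, Y w)) (Finset.univ ×ˢ Finset.univ.image Y) (by simp),
      Finset.sum_product_right, ← Finset.sum_sub_distrib]
    refine Finset.sum_congr rfl fun y hy => ?_
    have hsum : ∑ x, ((PMF.uniformOfFintype M).map (fun ω => (X ω, Y ω)) (x, y)).toReal = ((PMF.uniformOfFintype M).map Y y).toReal := by
      rw [← sum_map_prodMk_apply _ X Y y, ENNReal.toReal_sum fun x _ => PMF.apply_ne_top _ _]
    obtain ⟨w, -, rfl⟩ := Finset.mem_image.1 hy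
    have hpos : 0 < ((PMF.uniformOfFintype M).map Y (Y w)).toReal := by
      rw [toReal_map_uniformOfFintype_apply]
      exact div_pos (Nat.cast_pos.2 (fiberCard_pos _ w)) (Nat.cast_pos.2 Fintype.card_pos)
    -- Spreading this term over x allows the chain rule to be checked term by term.
    have hneg : Real.negMulLog ((PMF.uniformOfFintype M).map Y (Y w)).toReal =
        ∑ x, -(((PMF.uniformOfFintype M).map (fun ω => (X ω, Y ω)) (x, Y w)).toReal *
          Real.log ((PMF.uniformOfFintype M).map Y (Y w)).toReal) := by
      rw [Finset.sum_neg_distrib, ← Finset.sum_mul, hsum, Real.negMulLog, neg_mul]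
    rw [Finset.mul_sum, hneg, ← Finset.sum_sub_distrib]
    refine Finset.sum_congr rfl fun x _ => ?_
    rw [ENNReal.toReal_div]
    rcases eq_or_ne ((PMF.uniformOfFintype M).map (fun ω => (X ω, Y ω)) (x, Y w)).toReal 0 with h0 | h0
    · simp only [h0, zero_div, Real.negMulLog_zero, mul_zero, zero_mul, neg_zero, sub_zero]
    · rw [Real.negMulLog, Real.negMulLog, Real.log_div h0 hpos.ne']
      field_simp
      ring
  · intro y hy
    rw [map_uniformOfFintype_apply_eq_zero]
    · simp
    · simpa using hy

end CondEntropy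

/-! ### Independent symbols -/

section Product

variable {M M' α β : Type*} [Fintype M] [Fintype M']

lemma unifEntropy_comp_equiv (e : M' ≃ M) (Z : M → α) :
    unifEntropy (fun w => Z (e w)) = unifEntropy Z := by
  classical
  have h : ∀ w, fiberCard (fun w => Z (e w)) w = fiberCard Z (e w) := by
    intro w
    unfold fiberCard
    rw [← Finset.card_map e.toEmbedding]
    congr 1
    ext u
    simp
  simp only [unifEntropy, h, Fintype.card_congr e]
  rw [e.sum_comp fun w => Real.log ((Fintype.card M : ℝ) / fiberCard Z w)]

/-- Entropy of independent and identically distributed symbols. -/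
lemma unifEntropy_pi [Nonempty M] (N : ℕ) (g : M → α) :
    unifEntropy (fun (w : Fin N → M) i => g (w i)) = N * unifEntropy g := by
  classical
  have hM : (Fintype.card M : ℝ) ≠ 0 := by exact_mod_cast Fintype.card_ne_zero
  -- Fibres of a product map are products of fibres, so the logarithms add.
  have h : ∀ w, fiberCard (fun (w : Fin N → M) i => g (w i)) w = ∏ i, fiberCard g (w i) := by
    intro w
    unfold fiberCard
    rw [← Fintype.card_piFinset]
    congr 1
    ext u
    simp [funext_iff]
  have h2 : ∀ w : Fin N → M,
      Real.log ((Fintype.card (Fin N → M) : ℝ) / fiberCard (fun (w : Fin N → M) i => g (w i)) w) =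
        ∑ i, Real.log ((Fintype.card M : ℝ) / fiberCard g (w i)) := by
    intro w
    rw [h, ← Real.log_prod, Finset.prod_div_distrib]
    · simp
    · intro i _
      have : (0 : ℝ) < fiberCard g (w i) := Nat.cast_pos.2 (fiberCard_pos _ _)
      positivity
  unfold unifEntropy
  simp only [h2]
  rw [Finset.sum_comm]
  have h3 : ∀ i : Fin N, ∑ w : Fin N → M, Real.log ((Fintype.card M : ℝ) / fiberCard g (w i)) =
      (Fintype.card M : ℝ) ^ (N - 1) *
        ∑ b, Real.log ((Fintype.card M : ℝ) / fiberCard g b) := by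
    intro i
    have := Fintype.sum_piFinset_apply (fun b => Real.log ((Fintype.card M : ℝ) / fiberCard g b))
      Finset.univ i
    simpa using this
  rw [Finset.sum_congr rfl fun i _ => h3 i]
  rcases N with _ | N
  · simp
  · simp only [Finset.sum_const, Finset.card_univ, Fintype.card_fin, nsmul_eq_mul,
      Fintype.card_pi, Finset.prod_const, Nat.add_sub_cancel]
    push_cast
    field_simp
    ring

end Product

/-! ### Entropies of the candidate functions -/

section Images

variable {F : Type*} {f μ : ℕ} (φ : Fin μ → (Fin f → F) → F)

lemma firstImages_succ_iff {N : ℕ} (v : Fin μ) (u w : Messages F f N) :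
    firstImages φ (v.val + 1) u = firstImages φ (v.val + 1) w ↔
      image φ v u = image φ v w ∧ firstImages φ v.val u = firstImages φ v.val w := by
  simp only [firstImages, funext_iff (f := fun _ : {_u : Fin μ // _} => _), Subtype.forall]
  constructor
  · exact fun h => ⟨h v (Nat.lt_succ_self _), fun a ha => h a (Nat.lt_succ_of_lt ha)⟩
  · rintro ⟨h1, h2⟩ a ha
    rcases Nat.lt_succ_iff_lt_or_eq.1 ha with h | h
    · exact h2 a h
    · rwa [Fin.ext h]

variable [Fintype F] [Nonempty F]

lemma unifEntropy_firstImages (N k : ℕ) :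
    unifEntropy (firstImages φ k : Messages F f N → _) =
      N * (jointSymbolEntropy φ k * Real.log (Fintype.card F)) := by
  -- If |F| = 1, `entropy` divides by log 1 = 0; both sides then vanish.
  rcases eq_or_ne (Real.log (Fintype.card F)) 0 with h0 | h0
  · have hF : Subsingleton F := by
      have h1 : (Fintype.card F : ℝ) = 1 := by
        have : (0 : ℝ) < Fintype.card F := Nat.cast_pos.2 Fintype.card_pos
        rcases Real.log_eq_zero.1 h0 with h | h | h <;> linarith
      exact Fintype.card_le_one_iff_subsingleton.1 (by exact_mod_cast h1.le)
    rw [h0, mul_zero, mul_zero, ← unifEntropy_const (M := Messages F f N) ()]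
    exact unifEntropy_congr fun u w => by simp [Subsingleton.elim u w]
  rw [jointSymbolEntropy, entropy_map_uniformOfFintype, div_mul_cancel₀ _ h0, ← unifEntropy_pi,
    -- Transposing the messages exhibits the blocks as N independent columns.
    ← unifEntropy_comp_equiv (Equiv.piComm fun (_ : Fin f) (_ : Fin N) => F)]
  refine unifEntropy_congr fun u w => ?_
  simp only [firstImages, image, funext_iff]
  exact forall_comm

lemma condEntropy_image_firstImages (hF : 1 < Fintype.card F) (N : ℕ) (v : Fin μ) :
    condEntropy (Fintype.card F) (PMF.uniformOfFintype (Messages F f N)) (image φ v)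
      (firstImages φ v.val) =
        N * (jointSymbolEntropy φ (v.val + 1) - jointSymbolEntropy φ v.val) := by
  have hl : Real.log (Fintype.card F) ≠ 0 := (Real.log_pos (by exact_mod_cast hF)).ne'
  rw [condEntropy_uniformOfFintype, unifCondEntropy, unifEntropy_firstImages,
    unifEntropy_congr (Y := firstImages φ (v.val + 1)), unifEntropy_firstImages]
  · field_simp
  · intro u w
    rw [firstImages_succ_iff, Prod.mk.injEq]

lemma symbolEntropy_nonneg (v : Fin μ) : 0 ≤ symbolEntropy φ v := by
  rw [symbolEntropy, entropy_map_uniformOfFintype]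
  exact div_nonneg (unifEntropy_nonneg _) (Real.log_natCast_nonneg _)

lemma jointSymbolEntropy_mono : Monotone (jointSymbolEntropy φ) := by
  intro k l h
  rw [jointSymbolEntropy, jointSymbolEntropy, entropy_map_uniformOfFintype,
    entropy_map_uniformOfFintype]
  refine div_le_div_of_nonneg_right (unifEntropy_mono fun u w e => ?_) (Real.log_natCast_nonneg _)
  simp only [funext_iff, Subtype.forall] at e ⊢
  exact fun a ha => e a (ha.trans_le h)

lemma jointSymbolEntropy_zero : jointSymbolEntropy φ 0 = 0 := by
  rw [jointSymbolEntropy, entropy_map_uniformOfFintype,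
    unifEntropy_congr (Y := fun _ => ()), unifEntropy_const, zero_div]
  simp [funext_iff]

lemma symbolEntropy_le_jointSymbolEntropy (v : Fin μ) {k : ℕ} (h : v.val < k) :
    symbolEntropy φ v ≤ jointSymbolEntropy φ k := by
  rw [symbolEntropy, jointSymbolEntropy, entropy_map_uniformOfFintype,
    entropy_map_uniformOfFintype]
  refine div_le_div_of_nonneg_right (unifEntropy_mono fun u w e => ?_) (Real.log_natCast_nonneg _)
  simp only [funext_iff, Subtype.forall] at e
  exact e v h

end Images

/-! ### Averaging over the queries -/

/-- Expectation of a nonnegative function. -/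
def expect {α : Type*} (p : PMF α) (g : α → ℝ≥0∞) : ℝ≥0∞ := ∑' a, p a * g a

section Expect

variable {α β : Type*}

lemma expect_mono (p : PMF α) {g h : α → ℝ≥0∞} (hgh : ∀ a, g a ≤ h a) :
    expect p g ≤ expect p h :=
  ENNReal.tsum_le_tsum fun a => mul_le_mul_right (hgh a) _

lemma expect_add (p : PMF α) (g h : α → ℝ≥0∞) :
    expect p (fun a => g a + h a) = expect p g + expect p h := by
  simp only [expect, mul_add, ENNReal.tsum_add]

lemma expect_sum (p : PMF α) {ι : Type*} (s : Finset ι) (g : ι → α → ℝ≥0∞) :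
    expect p (fun a => ∑ i ∈ s, g i a) = ∑ i ∈ s, expect p (g i) := by
  classical
  induction s using Finset.induction_on with
  | empty => simp [expect]
  | insert i s hi ih => simp only [Finset.sum_insert hi, expect_add, ih]

lemma expect_const_mul (p : PMF α) (c : ℝ≥0∞) (g : α → ℝ≥0∞) :
    expect p (fun a => c * g a) = c * expect p g := by
  simp only [expect, mul_left_comm _ c, ENNReal.tsum_mul_left]

lemma expect_const (p : PMF α) (c : ℝ≥0∞) : expect p (fun _ => c) = c := by
  rw [expect, ENNReal.tsum_mul_right, p.tsum_coe, one_mul]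

lemma expect_bind (p : PMF α) (r : α → PMF β) (g : β → ℝ≥0∞) :
    expect (p.bind r) g = expect p fun a => expect (r a) g := by
  simp only [expect, PMF.bind_apply, ← ENNReal.tsum_mul_right, ← ENNReal.tsum_mul_left]
  rw [ENNReal.tsum_comm]
  simp only [mul_assoc]

lemma expect_pure (a : α) (g : α → ℝ≥0∞) : expect (PMF.pure a) g = g a := by
  rw [expect, tsum_eq_single a]
  · simp
  · intro b hb
    simp [PMF.pure_apply, hb]

lemma expect_map (p : PMF α) (h : α → β) (g : β → ℝ≥0∞) :
    expect (p.map h) g = expect p fun a => g (h a) := by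
  rw [← PMF.bind_pure_comp, expect_bind]
  simp [expect_pure]

lemma expect_uniformOfFintype {M : Type*} [Fintype M] [Nonempty M] (g : M → ℝ) (hg : ∀ w, 0 ≤ g w) :
    expect (PMF.uniformOfFintype M) (fun w => ENNReal.ofReal (g w)) =
      ENNReal.ofReal ((∑ w, g w) / Fintype.card M) := by
  have hM : (0 : ℝ) < Fintype.card M := Nat.cast_pos.2 Fintype.card_pos
  rw [expect, tsum_fintype, ENNReal.ofReal_div_of_pos hM, ENNReal.ofReal_sum_of_nonneg
    fun w _ => hg w, ENNReal.ofReal_natCast, div_eq_mul_inv, Finset.sum_mul]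
  simp only [PMF.uniformOfFintype_apply, mul_comm]

/-- A mixture whose components can be told apart by `c`. -/
lemma bind_map_apply_of_leftInverse {γ δ : Type*} (p : PMF α) (r : PMF γ) (g : α → γ → δ)
    (c : δ → α) (hc : ∀ a w, c (g a w) = a) (z : δ) :
    (p.bind fun a => r.map (g a)) z = p (c z) * r.map (g (c z)) z := by
  rw [PMF.bind_apply, tsum_eq_single (c z)]
  intro a ha
  rw [PMF.map_apply, ENNReal.tsum_eq_zero.2, mul_zero]
  exact fun w => if_neg fun h => ha (by rw [h, hc])

/-- Conditional entropy given a pair whose second entry is independent of the other data. -/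
lemma condEntropy_bind_map {M Ω : Type*} [Fintype M] [Nonempty M] [Fintype β] {q : ℕ} (hq : 1 < q)
    (p : PMF Ω) (X : M → β) (A : Ω → M → α) :
    ENNReal.ofReal (condEntropy q
        (p.bind fun Q => (PMF.uniformOfFintype M).map fun w => (Q, w))
        (fun ω => X ω.2) (fun ω => (A ω.1 ω.2, ω.1)) * Real.log q) =
      expect p fun Q => ENNReal.ofReal (unifCondEntropy X (A Q)) := by
  have hl : Real.log q ≠ 0 := (Real.log_pos (by exact_mod_cast hq)).ne'
  set u := PMF.uniformOfFintype M
  have hY : ∀ Q a, (p.bind fun Q => u.map fun w => (Q, w)).map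
      (fun ω => (A ω.1 ω.2, ω.1)) (a, Q) = p Q * u.map (A Q) a := by
    intro Q a
    rw [PMF.map_bind]
    simp only [PMF.map_comp, Function.comp_def]
    rw [bind_map_apply_of_leftInverse p u (fun Q w => (A Q w, Q)) Prod.snd (fun _ _ => rfl)]
    rw [PMF.map_apply, PMF.map_apply]
    congr 1
    refine tsum_congr fun w => ?_
    split_ifs <;> simp_all
  have hXY : ∀ Q a x, (p.bind fun Q => u.map fun w => (Q, w)).map
      (fun ω => (X ω.2, (A ω.1 ω.2, ω.1))) (x, (a, Q)) =
        p Q * u.map (fun w => (X w, A Q w)) (x, a) := by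
    intro Q a x
    rw [PMF.map_bind]
    simp only [PMF.map_comp, Function.comp_def]
    rw [bind_map_apply_of_leftInverse p u (fun Q w => (X w, (A Q w, Q))) (fun z => z.2.2)
      (fun _ _ => rfl)]
    rw [PMF.map_apply, PMF.map_apply]
    congr 1
    refine tsum_congr fun w => ?_
    split_ifs <;> simp_all
  rw [condEntropy_mul_log hq, ENNReal.tsum_prod', ENNReal.tsum_comm, expect]
  refine tsum_congr fun Q => ?_
  have := condEntropy_mul_log hq u X (A Q)
  rw [condEntropy_uniformOfFintype, div_mul_cancel₀ _ hl] at this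
  rw [this, ← ENNReal.tsum_mul_left]
  refine tsum_congr fun a => ?_
  rw [hY, mul_assoc]
  simp only [hXY]
  -- The factor p Q cancels in the conditional probability unless it is 0, and then the whole term
  -- has weight 0.
  rcases eq_or_ne (p Q) 0 with h0 | h0
  · simp [h0]
  · simp only [ENNReal.mul_div_mul_left _ _ h0 (p.apply_ne_top Q)]

end Expect

/-! ### Recovery, privacy and download cost of one scheme -/

namespace Scheme

variable {F : Type*} [Fintype F] [Nonempty F] {f n μ N : ℕ} (S : Scheme F f n μ N)
  (φ : Fin μ → (Fin f → F) → F)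

/-- `H(A_1^{(v)}, …, A_n^{(v)} | Q_1^{(v)}, …, Q_n^{(v)}, 𝐗^{[k]})`, in nats. -/
def answerEntropy (v : Fin μ) (k : ℕ) : ℝ≥0∞ :=
  expect (S.queryLaw v) fun Q => ENNReal.ofReal
    (unifCondEntropy (fun w j => S.answer v j (Q j) w) (firstImages φ k))

lemma condEntropy_add_answerEntropy_le (hF : 1 < Fintype.card F) (v : Fin μ) :
    ENNReal.ofReal (unifCondEntropy (image φ v : Messages F f N → _) (firstImages φ v.val)) +
        S.answerEntropy φ v (v.val + 1) ≤
      S.answerEntropy φ v v.val +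
        ENNReal.ofReal (S.equivocation φ v * Real.log (Fintype.card F)) := by
  have he : ENNReal.ofReal (S.equivocation φ v * Real.log (Fintype.card F)) =
      expect (S.queryLaw v) fun Q => ENNReal.ofReal (unifCondEntropy (image φ v)
        (fun w j => S.answer v j (Q j) w)) :=
    condEntropy_bind_map hF (S.queryLaw v) (image φ v) fun Q w j => S.answer v j (Q j) w
  rw [he, answerEntropy, answerEntropy, ← expect_add,
    ← expect_const (S.queryLaw v) (ENNReal.ofReal (unifCondEntropy _ _)), ← expect_add]
  refine expect_mono _ fun Q => ?_
  rw [← ENNReal.ofReal_add (unifCondEntropy_nonneg _ _) (unifCondEntropy_nonneg _ _),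
    ← ENNReal.ofReal_add (unifCondEntropy_nonneg _ _) (unifCondEntropy_nonneg _ _)]
  exact ENNReal.ofReal_le_ofReal (unifCondEntropy_exchange _ _ _ _ (firstImages_succ_iff φ v))

variable {S φ} in
-- The query is part of the triple whose law is private. Hence the law of the query to j is the same
-- for both indices, and so is, for each query of positive probability, the law of the answer
-- jointly with all blocks.
lemma IsPrivate.expect_unifCondEntropy_eq (h : S.IsPrivate φ) (v v' : Fin μ) (j : Fin n) (k : ℕ) :
    expect (S.queryLaw v) (fun Q => ENNReal.ofReal
        (unifCondEntropy (S.answer v j (Q j)) (firstImages φ k))) =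
      expect (S.queryLaw v') (fun Q => ENNReal.ofReal
        (unifCondEntropy (S.answer v' j (Q j)) (firstImages φ k))) := by
  set u := PMF.uniformOfFintype (Messages F f N)
  have hlaw : ∀ v, (S.law v).map (fun ω => (ω.1 j, S.answers v ω j, fun u => image φ u ω.2)) =
      ((S.queryLaw v).map fun Q => Q j).bind fun x =>
        u.map fun w => (x, S.answer v j x w, fun u => image φ u w) := by
    intro v
    rw [law, PMF.map_bind, PMF.bind_map]
    simp only [PMF.map_comp, Function.comp_def, answers, u]
  have hp := h v v' j
  rw [hlaw, hlaw] at hp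
  have hq : ((S.queryLaw v).map fun Q => Q j) = (S.queryLaw v').map fun Q => Q j := by
    have hc : ∀ x : S.Query, u.map (fun _ => x) = PMF.pure x := fun x => PMF.map_const u x
    have := congrArg (PMF.map Prod.fst) hp
    simpa only [PMF.map_bind, PMF.map_comp, Function.comp_def, hc, PMF.bind_pure] using this
  rw [← expect_map (S.queryLaw v) (fun Q => Q j) fun x => ENNReal.ofReal
      (unifCondEntropy (S.answer v j x) (firstImages φ k)),
    ← expect_map (S.queryLaw v') (fun Q => Q j) fun x => ENNReal.ofReal
      (unifCondEntropy (S.answer v' j x) (firstImages φ k)), hq]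
  refine tsum_congr fun x => ?_
  rcases eq_or_ne (((S.queryLaw v').map fun Q => Q j) x) 0 with h0 | h0
  · rw [h0, zero_mul, zero_mul]
  have hx : (u.map fun w => (x, S.answer v j x w, fun u => image φ u w)) =
      u.map fun w => (x, S.answer v' j x w, fun u => image φ u w) := by
    ext z
    rcases eq_or_ne z.1 x with hz | hz
    · have := DFunLike.congr_fun hp z
      rw [bind_map_apply_of_leftInverse _ _ _ Prod.fst (fun _ _ => rfl),
        bind_map_apply_of_leftInverse _ _ _ Prod.fst (fun _ _ => rfl), hq, hz] at this
      exact (ENNReal.mul_right_inj h0 (PMF.apply_ne_top _ _)).1 this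
    · rw [map_uniformOfFintype_apply_eq_zero _ fun w e => hz (by rw [← e]),
        map_uniformOfFintype_apply_eq_zero _ fun w e => hz (by rw [← e])]
  have hx' := congrArg (PMF.map fun z => (z.2.1, fun i : {i : Fin μ // i.val < k} => z.2.2 i.val)) hx
  simp only [PMF.map_comp, Function.comp_def] at hx'
  have e : unifEntropy (fun w => (S.answer v j x w, firstImages φ k w)) =
      unifEntropy (fun w => (S.answer v' j x w, firstImages φ k w)) :=
    unifEntropy_eq_of_map_eq hx'
  simp only [unifCondEntropy, e]

variable {S φ} in
lemma IsPrivate.answerEntropy_le (h : S.IsPrivate φ) (v v' : Fin μ) (k : ℕ) :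
    S.answerEntropy φ v' k ≤ n * S.answerEntropy φ v k := by
  calc S.answerEntropy φ v' k
      ≤ expect (S.queryLaw v') fun Q => ∑ j, ENNReal.ofReal
          (unifCondEntropy (S.answer v' j (Q j)) (firstImages φ k)) := by
        refine expect_mono _ fun Q => ?_
        rw [← ENNReal.ofReal_sum_of_nonneg fun j _ => unifCondEntropy_nonneg _ _]
        exact ENNReal.ofReal_le_ofReal (unifCondEntropy_pi_le _)
    _ = expect (S.queryLaw v) fun Q => ∑ j, ENNReal.ofReal
          (unifCondEntropy (S.answer v j (Q j)) (firstImages φ k)) := by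
        rw [expect_sum, expect_sum]
        exact Finset.sum_congr rfl fun j _ => h.expect_unifCondEntropy_eq v' v j k
    _ ≤ expect (S.queryLaw v) fun Q => n * ENNReal.ofReal
          (unifCondEntropy (fun w j => S.answer v j (Q j) w) (firstImages φ k)) := by
        refine expect_mono _ fun Q => ?_
        rw [← ENNReal.ofReal_sum_of_nonneg fun j _ => unifCondEntropy_nonneg _ _,
          ← ENNReal.ofReal_natCast, ← ENNReal.ofReal_mul (by positivity)]
        exact ENNReal.ofReal_le_ofReal (sum_unifCondEntropy_le _)
    _ = n * S.answerEntropy φ v k := expect_const_mul _ _ _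

lemma answerEntropy_zero_le (v : Fin μ) {δ : ℝ} (hδ : 0 < δ) :
    S.answerEntropy φ v 0 ≤ ENNReal.ofReal (Real.log (Fintype.card F) + δ) * S.downloadCost +
      ENNReal.ofReal (n * -Real.log (1 - Real.exp (-δ))) := by
  set u := PMF.uniformOfFintype (Messages F f N)
  set c := Real.log (Fintype.card F) + δ
  set d := -Real.log (1 - Real.exp (-δ))
  have hc : 0 ≤ c := add_nonneg (Real.log_natCast_nonneg _) hδ.le
  have hd : 0 ≤ d := by
    have : Real.exp (-δ) < 1 := by simpa using hδ
    exact neg_nonneg.2 (Real.log_nonpos (by linarith) (by linarith [Real.exp_pos (-δ)]))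
  have hD : expect (S.queryLaw v) (fun Q => ENNReal.ofReal
      ((∑ w, ∑ j, ((S.answer v j (Q j) w).length : ℝ)) / Fintype.card (Messages F f N))) ≤
        S.downloadCost := by
    refine le_trans (le_of_eq ?_) (le_iSup (fun v => ∑' ω, S.law v ω *
      ∑ j, ((S.answers v ω j).length : ℝ≥0∞)) v)
    change _ = expect (S.law v) fun ω => ∑ j, ((S.answers v ω j).length : ℝ≥0∞)
    rw [law, expect_bind]
    congr 1
    funext Q
    rw [expect_map, ← expect_uniformOfFintype _ fun w =>
      Finset.sum_nonneg fun j _ => Nat.cast_nonneg _]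
    congr 1
    funext w
    rw [ENNReal.ofReal_sum_of_nonneg fun j _ => Nat.cast_nonneg _]
    simp [answers]
  refine le_trans ?_ (add_le_add_left (mul_le_mul_right hD _) _)
  rw [← expect_const_mul, ← expect_const (S.queryLaw v) (ENNReal.ofReal (n * d)), ← expect_add]
  refine expect_mono _ fun Q => ?_
  rw [← ENNReal.ofReal_mul hc, ← ENNReal.ofReal_add (by positivity) (by positivity)]
  refine ENNReal.ofReal_le_ofReal ((unifCondEntropy_pi_le _).trans ?_)
  calc _ ≤ ∑ j, (c * ((∑ w, ((S.answer v j (Q j) w).length : ℝ)) /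
          Fintype.card (Messages F f N)) + d) := by
        refine Finset.sum_le_sum fun j _ => ?_
        -- For k = 0 the family of known blocks is empty, so the conditioning is vacuous.
        rw [unifCondEntropy_of_forall_eq]
        · exact (unifEntropy_list_le _ hδ).trans (le_of_eq (sub_eq_add_neg _ _))
        · intro u w
          simp [firstImages, funext_iff]
    _ = _ := by
        rw [Finset.sum_add_distrib, ← Finset.mul_sum, ← Finset.sum_div, Finset.sum_comm]
        simp

end Scheme

/-- Unrolling a chain of inequalities that loses a factor `n` in each step. -/
lemma sum_div_pow_le_of_chain {n : ℕ} (hn : 1 ≤ n) {μ : ℕ} (C e a b : ℕ → ℝ≥0∞)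
    (h1 : ∀ i < μ, C i + b i ≤ a i + e i) (h2 : ∀ i, i + 1 < μ → a (i + 1) ≤ n * b i) :
    ∀ m < μ, ∑ i ∈ Finset.range (m + 1), C i / (n : ℝ≥0∞) ^ i + b m / (n : ℝ≥0∞) ^ m ≤
      a 0 + ∑ i ∈ Finset.range (m + 1), e i / (n : ℝ≥0∞) ^ i := by
  have hn0 : (n : ℝ≥0∞) ≠ 0 := by exact_mod_cast (by omega : n ≠ 0)
  intro m
  induction m with
  | zero => intro hm; simpa using h1 0 hm
  | succ m ih =>
    intro hm
    rw [Finset.sum_range_succ, Finset.sum_range_succ (fun i => e i / (n : ℝ≥0∞) ^ i)]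
    have hb : a (m + 1) / (n : ℝ≥0∞) ^ (m + 1) ≤ b m / (n : ℝ≥0∞) ^ m := by
      calc _ ≤ n * b m / (n : ℝ≥0∞) ^ (m + 1) := ENNReal.div_le_div_right (h2 m hm) _
        _ = _ := by
          rw [pow_succ', ENNReal.mul_div_mul_left _ _ hn0 (ENNReal.natCast_ne_top n)]
    calc _ = ∑ i ∈ Finset.range (m + 1), C i / (n : ℝ≥0∞) ^ i +
          (C (m + 1) + b (m + 1)) / (n : ℝ≥0∞) ^ (m + 1) := by
          rw [ENNReal.add_div, add_assoc]
      _ ≤ ∑ i ∈ Finset.range (m + 1), C i / (n : ℝ≥0∞) ^ i +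
          (a (m + 1) + e (m + 1)) / (n : ℝ≥0∞) ^ (m + 1) := by
          exact add_le_add_right (ENNReal.div_le_div_right (h1 _ hm) _) _
      _ ≤ ∑ i ∈ Finset.range (m + 1), C i / (n : ℝ≥0∞) ^ i +
          (b m / (n : ℝ≥0∞) ^ m + e (m + 1) / (n : ℝ≥0∞) ^ (m + 1)) := by
          rw [ENNReal.add_div]
          gcongr
      _ ≤ _ := by
          rw [← add_assoc, ← add_assoc]
          exact add_le_add_left (ih (by omega)) _

/-- The converse bound for a single private scheme. -/
lemma Scheme.IsPrivate.sum_condEntropy_le {F : Type*} [Fintype F] [Nonempty F] {f n μ N : ℕ}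
    {S : Scheme F f n μ N} {φ : Fin μ → (Fin f → F) → F} (h : S.IsPrivate φ)
    (hF : 1 < Fintype.card F) (hn : 1 ≤ n) (hμ : 1 ≤ μ) {δ : ℝ} (hδ : 0 < δ) :
    ENNReal.ofReal (∑ v : Fin μ, unifCondEntropy (image φ v : Messages F f N → _)
        (firstImages φ v.val) / (n : ℝ) ^ v.val) ≤
      ENNReal.ofReal (Real.log (Fintype.card F) + δ) * S.downloadCost +
        ENNReal.ofReal (n * -Real.log (1 - Real.exp (-δ))) +
        ENNReal.ofReal ((∑ v, S.equivocation φ v) * Real.log (Fintype.card F)) := by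
  have hn0 : 0 < n := hn
  have key := sum_div_pow_le_of_chain (μ := μ) hn
    -- The last two sequences are the answer entropies for index i before and after its own block
    -- becomes known.
    (fun i => if hi : i < μ then ENNReal.ofReal (unifCondEntropy
      (image φ ⟨i, hi⟩ : Messages F f N → _) (firstImages φ i)) else 0)
    (fun i => if hi : i < μ then ENNReal.ofReal (S.equivocation φ ⟨i, hi⟩ *
      Real.log (Fintype.card F)) else 0)
    (fun i => if hi : i < μ then S.answerEntropy φ ⟨i, hi⟩ i else 0)
    (fun i => if hi : i < μ then S.answerEntropy φ ⟨i, hi⟩ (i + 1) else 0)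
    (fun i hi => by
      simp only [dif_pos hi]
      exact S.condEntropy_add_answerEntropy_le φ hF ⟨i, hi⟩)
    (fun i hi => by
      simp only [dif_pos hi, dif_pos (Nat.lt_of_succ_lt hi)]
      exact h.answerEntropy_le _ _ _) (μ - 1) (by omega)
  rw [Nat.sub_add_cancel hμ, Finset.sum_range, Finset.sum_range] at key
  simp only [Fin.is_lt, dif_pos, Fin.eta, dif_pos (show 0 < μ from hμ)] at key
  have hl : 0 ≤ Real.log (Fintype.card F) := Real.log_natCast_nonneg _
  rw [ENNReal.ofReal_sum_of_nonneg fun v _ =>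
    div_nonneg (unifCondEntropy_nonneg _ _) (by positivity), Finset.sum_mul,
    ENNReal.ofReal_sum_of_nonneg (f := fun v => S.equivocation φ v * _)
      fun v _ => mul_nonneg (condEntropy_nonneg _ _ _ _) hl]
  calc _ = ∑ v : Fin μ, ENNReal.ofReal (unifCondEntropy (image φ v : Messages F f N → _)
        (firstImages φ v.val)) / (n : ℝ≥0∞) ^ v.val := by
        refine Finset.sum_congr rfl fun v _ => ?_
        rw [ENNReal.ofReal_div_of_pos (by positivity), ENNReal.ofReal_pow (by positivity),
          ENNReal.ofReal_natCast]
    _ ≤ _ := le_self_add.trans key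
    _ ≤ _ := by
        gcongr with v
        · exact S.answerEntropy_zero_le φ _ hδ
        -- The equivocations need no weights: dropping n^i ≥ 1 only enlarges the error.
        · refine ENNReal.div_le_of_le_mul (le_mul_of_one_le_right zero_le ?_)
          exact one_le_pow₀ (by exact_mod_cast hn)

/-! ### Passage to large L -/

section Asymptotic

variable {F : Type*} [Fintype F] [Nonempty F] {f n μ : ℕ} {φ : Fin μ → (Fin f → F) → F}

lemma sum_condEntropy_image (hF : 1 < Fintype.card F) (N : ℕ) :
    ∑ v : Fin μ, condEntropy (Fintype.card F) (PMF.uniformOfFintype (Messages F f N)) (image φ v)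
        (firstImages φ v.val) / (n : ℝ) ^ v.val =
      N * ∑ v : Fin μ, (jointSymbolEntropy φ (v.val + 1) - jointSymbolEntropy φ v.val) /
        (n : ℝ) ^ v.val := by
  rw [Finset.mul_sum]
  refine Finset.sum_congr rfl fun v _ => ?_
  rw [condEntropy_image_firstImages φ hF, mul_div_assoc]

lemma sum_jointSymbolEntropy_sub_nonneg :
    0 ≤ ∑ v : Fin μ, (jointSymbolEntropy φ (v.val + 1) - jointSymbolEntropy φ v.val) /
      (n : ℝ) ^ v.val :=
  Finset.sum_nonneg fun v _ =>
    div_nonneg (sub_nonneg.2 (jointSymbolEntropy_mono φ (Nat.le_succ _))) (by positivity)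

/-- Every private computation protocol obeys the lower bound on the download cost. -/
lemma IsPCProtocol.eventually_le_downloadCost (hF : 1 < Fintype.card F) (hn : 1 ≤ n) (hμ : 1 ≤ μ)
    {β : ℕ} {S : ∀ L : ℕ, Scheme F f n μ (β * L)} (hS : IsPCProtocol φ β S) {ε : ℝ} (hε : 0 < ε) :
    ∀ᶠ L : ℕ in atTop, ENNReal.ofReal (∑ v : Fin μ, condEntropy (Fintype.card F)
        (PMF.uniformOfFintype (Messages F f (β * L))) (image φ v) (firstImages φ v.val) /
          (n : ℝ) ^ v.val) ≤ (S L).downloadCost + ENNReal.ofReal (ε * L) := by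
  set K : ℝ := β * ∑ v : Fin μ, (jointSymbolEntropy φ (v.val + 1) - jointSymbolEntropy φ v.val) /
    (n : ℝ) ^ v.val
  have hK : 0 ≤ K := mul_nonneg (Nat.cast_nonneg _) sum_jointSymbolEntropy_sub_nonneg
  set l := Real.log (Fintype.card F)
  have hl : 0 < l := Real.log_pos (by exact_mod_cast hF)
  have hR : ∀ L : ℕ, ∑ v : Fin μ, condEntropy (Fintype.card F)
      (PMF.uniformOfFintype (Messages F f (β * L))) (image φ v) (firstImages φ v.val) /
        (n : ℝ) ^ v.val = K * L := by
    intro L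
    rw [sum_condEntropy_image hF]
    push_cast
    ring
  -- Three errors, δD, the constant c and the equivocation, each get a third of lεL. The summand 1
  -- guards against K = 0.
  set δ := l * ε / (3 * (K + 1))
  have hδ : 0 < δ := by positivity
  have hδK : δ * K ≤ l * ε / 3 := by
    have : δ * (K + 1) = l * ε / 3 := by simp only [δ]; field_simp
    nlinarith
  set c := n * -Real.log (1 - Real.exp (-δ))
  have hc : 0 ≤ c := by
    have : Real.exp (-δ) < 1 := by simpa using hδ
    exact mul_nonneg (Nat.cast_nonneg _)
      (neg_nonneg.2 (Real.log_nonpos (by linarith) (by linarith [Real.exp_pos (-δ)])))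
  have ho : (fun L : ℕ => ∑ v, (S L).equivocation φ v) =o[atTop] fun L : ℕ => (L : ℝ) :=
    (IsLittleO.sum (s := Finset.univ) fun v _ => hS.2 v).congr_left fun L => Finset.sum_apply _ _ _
  filter_upwards [ho.bound (show 0 < ε / 3 by positivity),
    tendsto_natCast_atTop_atTop.eventually_ge_atTop (c / (l * ε / 3))] with L he hL
  have he' : ∑ v, (S L).equivocation φ v ≤ ε / 3 * L := by
    have := (le_abs_self _).trans he
    simpa using this
  have he0 : 0 ≤ ∑ v, (S L).equivocation φ v :=
    Finset.sum_nonneg fun v _ => condEntropy_nonneg _ _ _ _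
  have hL' : c ≤ l * ε / 3 * L := by
    rw [div_le_iff₀ (by positivity)] at hL
    linarith
  rw [hR]
  -- A cost of at least KL already satisfies the claim. Otherwise the cost is finite and below KL,
  -- which controls δD.
  rcases le_or_gt (ENNReal.ofReal (K * L)) (S L).downloadCost with hD | hD
  · exact hD.trans le_self_add
  obtain ⟨d, hd0, hd⟩ : ∃ d : ℝ, 0 ≤ d ∧ (S L).downloadCost = ENNReal.ofReal d :=
    ⟨_, ENNReal.toReal_nonneg, (ENNReal.ofReal_toReal (hD.trans_le le_top).ne).symm⟩
  have key := (hS.1 L).sum_condEntropy_le hF hn hμ hδ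
  have hkey : ∑ v : Fin μ, unifCondEntropy (image φ v : Messages F f (β * L) → _)
      (firstImages φ v.val) / (n : ℝ) ^ v.val = l * (K * L) := by
    rw [← hR, Finset.mul_sum]
    refine Finset.sum_congr rfl fun v _ => ?_
    rw [condEntropy_uniformOfFintype]
    change _ = l * (_ / l / _)
    field_simp
  rw [hkey, hd, ← ENNReal.ofReal_mul (by positivity), ← ENNReal.ofReal_add (by positivity) hc,
    ← ENNReal.ofReal_add (by positivity) (by positivity),
    ENNReal.ofReal_le_ofReal_iff (by positivity)] at key
  rw [hd] at hD ⊢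
  have hdK : d < K * L := (ENNReal.ofReal_lt_ofReal_iff_of_nonneg hd0).1 hD
  rw [← ENNReal.ofReal_add hd0 (by positivity)]
  refine ENNReal.ofReal_le_ofReal (le_of_mul_le_mul_left ?_ hl)
  have h1 : δ * d ≤ l * ε / 3 * L := by
    calc δ * d ≤ δ * (K * L) := by gcongr
      _ = δ * K * L := by ring
      _ ≤ _ := by gcongr
  have h2 : (∑ v, (S L).equivocation φ v) * l ≤ ε / 3 * L * l := by gcongr
  change l * (K * L) ≤ (l + δ) * d + c + (∑ v, (S L).equivocation φ v) * l at key
  linarith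

lemma minEntropy_nonneg : 0 ≤ minEntropy φ :=
  Real.iInf_nonneg fun v => symbolEntropy_nonneg φ v

/-- The first summand alone is H(X^{(1)}). In particular, the denominator of the capacity bound is
positive when H_min is. -/
lemma minEntropy_le_sum (hμ : 1 ≤ μ) :
    minEntropy φ ≤ ∑ v : Fin μ, (jointSymbolEntropy φ (v.val + 1) - jointSymbolEntropy φ v.val) /
      (n : ℝ) ^ v.val := by
  calc minEntropy φ ≤ symbolEntropy φ ⟨0, hμ⟩ := ciInf_le (Set.finite_range _).bddBelow _
    _ ≤ jointSymbolEntropy φ 1 := symbolEntropy_le_jointSymbolEntropy φ _ Nat.zero_lt_one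
    _ = (jointSymbolEntropy φ ((⟨0, hμ⟩ : Fin μ).val + 1) -
          jointSymbolEntropy φ (⟨0, hμ⟩ : Fin μ).val) / (n : ℝ) ^ (⟨0, hμ⟩ : Fin μ).val := by
        simp [jointSymbolEntropy_zero]
    _ ≤ _ := Finset.single_le_sum (f := fun v : Fin μ => (jointSymbolEntropy φ (v.val + 1) -
          jointSymbolEntropy φ v.val) / (n : ℝ) ^ v.val) (fun v _ => div_nonneg
            (sub_nonneg.2 (jointSymbolEntropy_mono φ (Nat.le_succ _))) (by positivity))
              (Finset.mem_univ _)

lemma sum_Icc_pow_mul (hn : 1 ≤ n) (J : ℕ → ℝ) :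
    ∑ v ∈ Finset.Icc 1 μ, (n : ℝ) ^ (μ - v + 1) * (J v - J (v - 1)) =
      (n : ℝ) ^ μ * ∑ v : Fin μ, (J (v.val + 1) - J v.val) / (n : ℝ) ^ v.val := by
  have hn0 : (n : ℝ) ≠ 0 := by positivity
  rw [← Finset.sum_range fun v => (J (v + 1) - J v) / (n : ℝ) ^ v, Finset.mul_sum,
    Finset.range_eq_Ico, ← Finset.Ico_add_one_right_eq_Icc,
    ← Finset.sum_Ico_add' (fun v => (n : ℝ) ^ (μ - v + 1) * (J v - J (v - 1))) 0 μ 1]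
  refine Finset.sum_congr rfl fun v hv => ?_
  have hv : v < μ := (Finset.mem_Ico.1 hv).2
  have : (n : ℝ) ^ μ = (n : ℝ) ^ (μ - (v + 1) + 1) * (n : ℝ) ^ v := by
    rw [← pow_add]; congr 1; omega
  rw [this, Nat.add_sub_cancel]
  field_simp

lemma IsPCProtocol.limsup_rate_le (hF : 1 < Fintype.card F) (hn : 1 ≤ n) (hμ : 1 ≤ μ)
    {β : ℕ} (hβ : 1 ≤ β) {S : ∀ L : ℕ, Scheme F f n μ (β * L)} (hS : IsPCProtocol φ β S) :
    limsup (fun L => (S L).rate φ) atTop ≤ ENNReal.ofReal (minEntropy φ /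
      ∑ v : Fin μ, (jointSymbolEntropy φ (v.val + 1) - jointSymbolEntropy φ v.val) /
        (n : ℝ) ^ v.val) := by
  rcases minEntropy_nonneg.eq_or_lt (a := (0 : ℝ)) (b := minEntropy φ) with h0 | hpos
  · simp [Scheme.rate, ← h0]
  have hβ0 : (0 : ℝ) < β := by exact_mod_cast hβ
  have hle := minEntropy_le_sum (n := n) (φ := φ) hμ
  set s := ∑ v : Fin μ, (jointSymbolEntropy φ (v.val + 1) - jointSymbolEntropy φ v.val) /
    (n : ℝ) ^ v.val with hs
  have hs0 : 0 < s := hpos.trans_le hle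
  -- For each small ε the cost is eventually at least L(βs - ε), which bounds the rate by this
  -- function of ε; then ε tends to 0.
  have hlim : Tendsto (fun ε : ℝ => ENNReal.ofReal (β * minEntropy φ / (β * s - ε))) (𝓝[>] 0)
      (𝓝 (ENNReal.ofReal (minEntropy φ / s))) := by
    have h1 : minEntropy φ / s = β * minEntropy φ / (β * s - 0) := by
      rw [sub_zero]; field_simp
    rw [h1]
    refine (ENNReal.tendsto_ofReal (Tendsto.div tendsto_const_nhds (tendsto_const_nhds.sub
      tendsto_id) ?_)).mono_left nhdsWithin_le_nhds
    rw [sub_zero]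
    positivity
  refine ge_of_tendsto hlim ?_
  have hlt : ∀ᶠ ε : ℝ in 𝓝[>] 0, ε < β * s :=
    nhdsWithin_le_nhds (eventually_lt_nhds (by positivity))
  filter_upwards [hlt, self_mem_nhdsWithin] with ε hε1 hε0
  refine limsup_le_of_le (by isBoundedDefault) ?_
  filter_upwards [hS.eventually_le_downloadCost hF hn hμ hε0, eventually_gt_atTop 0] with L hL hL0
  have hL0' : (0 : ℝ) < L := by exact_mod_cast hL0
  rw [sum_condEntropy_image hF, ← hs] at hL
  have hD : ENNReal.ofReal (L * (β * s - ε)) ≤ (S L).downloadCost := by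
    have h : L * (β * s - ε) = ((β * L : ℕ) : ℝ) * s - ε * L := by push_cast; ring
    rw [h, ENNReal.ofReal_sub _ (by have : (0 : ℝ) < ε := hε0; positivity)]
    exact tsub_le_iff_right.2 hL
  have hpos' : 0 < L * (β * s - ε) := mul_pos hL0' (sub_pos.2 hε1)
  calc (S L).rate φ ≤ ENNReal.ofReal (((β * L : ℕ) : ℝ) * minEntropy φ) /
        ENNReal.ofReal (L * (β * s - ε)) := ENNReal.div_le_div_left hD _
    _ = ENNReal.ofReal (β * minEntropy φ / (β * s - ε)) := by
        rw [← ENNReal.ofReal_div_of_pos hpos']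
        congr 1
        have : β * s - ε ≠ 0 := (sub_pos.2 hε1).ne'
        push_cast
        field_simp

end Asymptotic

end

end PrivateComputation

theorem theorem1 {F : Type*} [Field F] [Fintype F] (n f μ : ℕ) (hn : 1 ≤ n) (hμ : 1 ≤ μ)
    (φ : Fin μ → (Fin f → F) → F) :
    PrivateComputation.capacity n φ ≤
        ENNReal.ofReal ((n : ℝ) ^ μ * PrivateComputation.minEntropy φ /
          ∑ v ∈ Finset.Icc 1 μ, (n : ℝ) ^ (μ - v + 1) *
            (PrivateComputation.jointSymbolEntropy φ v -
              PrivateComputation.jointSymbolEntropy φ (v - 1))) ∧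
      ∀ (β : ℕ), 1 ≤ β →
        ∀ S : ∀ L : ℕ, PrivateComputation.Scheme F f n μ (β * L),
          PrivateComputation.IsPCProtocol φ β S →
          ∀ ε : ℝ, 0 < ε → ∀ᶠ L : ℕ in atTop,
            ENNReal.ofReal (∑ v : Fin μ,
                PrivateComputation.condEntropy (Fintype.card F)
                  (PMF.uniformOfFintype (PrivateComputation.Messages F f (β * L)))
                  (PrivateComputation.image φ v) (PrivateComputation.firstImages φ v.val) /
                (n : ℝ) ^ v.val) ≤
              (S L).downloadCost + ENNReal.ofReal (ε * L) := by
  have hF : 1 < Fintype.card F := Fintype.one_lt_card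
  refine ⟨?_, fun β _ S hS ε hε => hS.eventually_le_downloadCost hF hn hμ hε⟩
  have hn0 : (n : ℝ) ^ μ ≠ 0 := by positivity
  rw [PrivateComputation.sum_Icc_pow_mul hn, mul_div_mul_left _ _ hn0]
  exact iSup_le fun β => iSup_le fun hβ => iSup_le fun S => iSup_le fun hS =>
    hS.limsup_rate_le hF hn hμ hβ
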